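/- Let $\alpha>0$ and let $\Pi=\{z\in\mathbb C:\operatorname{Im} z>0\}$. Let $H_\alpha$ be the Hilbert space of holomorphic functions on $\Pi$ with reproducing kernel $K(z,u)=\bigl(\frac{z-\overline u}{2i}\bigr)^{-\alpha}$ (principal branch), that is, $\langle F,K(\cdot,u)\rangle=F(u)$ for all $F\in H_\alpha$, $u\in\Pi$. Let $$d\mu(s)=\frac{1}{2\pi\Gamma(\alpha)}\,\bigl|\Gamma(\alpha/2+is)\bigr|^2\,ds\qquad\text{on }\mathbb R .$$ For $g=\begin{pmatrix}a&b\\c&d\end{pmatrix}\in \mathrm{SL}_2(\mathbb R)$ put $T_\alpha(g)F(z)=F\bigl(\frac{b+zd}{a+zc}\bigr)(a+zc)^{-\alpha}$ (principal branch), and for $a>0$ let $D(a)=\operatorname{diag}(a^{1/2},a^{-1/2})$, so that $T_\alpha(D(a))F(z)=F(a^{-1}z)\,a^{-\alpha/2}$. Let $\tau_\alpha(D(a))f(s)=f(s)\,a^{is}$ for $f\in L^2(\mathbb R,d\mu)$. Then for every $f\in L^2(\mathbb R,d\mu)$ and $z\in\Pi$ the integral $$J_\alpha f(z)=\frac{2^{\alpha/2}}{2\pi\Gamma(\alpha)}\int_{-\infty}^{\infty}f(s)\left(\frac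 zi\right)^{-\alpha/2-is}\bigl|\Gamma(\alpha/2+is)\bigr|^2\,ds ,$$ where $(z/i)^{-\alpha/2-is}=e^{-(\alpha/2+is)\ln(z/i)}$ with $\ln(z/i)$ real for $z=ip$, $p>0$, converges absolutely, and $J_\alpha$ is a unitary operator from $L^2(\mathbb R,d\mu)$ onto $H_\alpha$. It intertwines the two actions of the diagonal subgroup: $J_\alpha\,\tau_\alpha(D(a))=T_\alpha(D(a))\,J_\alpha$ for every $a>0$. -/

import Mathlib

noncomputable section

namespace VilenkinMellin

open MeasureTheory ProbabilityTheory Complex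
open scoped ComplexConjugate UpperHalfPlane

/-- The kernel `K(z, u) = ((z - conj u) / (2i))^{-α}` on the upper half-plane. The base has positive
real part, so the principal branch is the one which is positive for `u = z`. -/
def halfPlaneKernel (α : ℝ) (z u : ℍ) : ℂ :=
  (((z : ℂ) - conj (u : ℂ)) / (2 * I)) ^ (-(α : ℂ))

/-- The measure `t^{α-1} dt` on `(0, ∞)`; it only serves to prove that the kernel is positive
semidefinite. -/
def laplaceMeasure (α : ℝ) : Measure ℝ :=
  (volume.restrict (Set.Ioi 0)).withDensity fun t => ENNReal.ofReal (t ^ (α - 1))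

theorem integrable_exp_laplaceMeasure {α : ℝ} (hα : 0 < α) {r : ℝ} (hr : r < 0) :
    Integrable (fun t : ℝ => Real.exp (r * t)) (laplaceMeasure α) := by
  rw [laplaceMeasure, integrable_withDensity_iff (by fun_prop) (by simp)]
  have h := integrableOn_rpow_mul_exp_neg_mul_rpow (s := α - 1) (p := 1) (b := -r)
    (by linarith) one_pos (by linarith)
  refine h.congr_fun (fun t ht => ?_) measurableSet_Ioi
  have ht : 0 < t := ht
  simp [ENNReal.toReal_ofReal (Real.rpow_nonneg ht.le _), mul_comm]

theorem integral_exp_laplaceMeasure {α : ℝ} (hα : 0 < α) {r : ℝ} (hr : 0 < r) :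
    ∫ t, cexp ((-r : ℂ) * t) ∂(laplaceMeasure α) = (r : ℂ) ^ (-(α : ℂ)) * Complex.Gamma α := by
  rw [laplaceMeasure, integral_withDensity_eq_integral_toReal_smul (by fun_prop) (by simp)]
  have h := integral_cpow_mul_exp_neg_mul_Ioi (a := α) (by simpa using hα) hr
  rw [one_div, Complex.inv_cpow _ _ (by simp [Complex.arg_ofReal_of_nonneg hr.le, Real.pi_ne_zero.symm]),
    ← Complex.cpow_neg] at h
  rw [← h]
  refine setIntegral_congr_fun measurableSet_Ioi (fun t ht => ?_)
  have ht : 0 < t := ht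
  simp [ENNReal.toReal_ofReal (Real.rpow_nonneg ht.le _), Complex.ofReal_cpow ht.le]

theorem complexMGF_laplaceMeasure {α : ℝ} (hα : 0 < α) {w : ℂ} (hw : 0 < w.re) :
    ∫ t, cexp (-w * t) ∂(laplaceMeasure α) = w ^ (-(α : ℂ)) * Complex.Gamma α := by
  set U : Set ℂ := {z | 0 < z.re} with hU
  have hUo : IsOpen U := isOpen_lt continuous_const Complex.continuous_re
  have hUc : IsPreconnected U := (convex_halfSpace_re_gt 0).isPreconnected
  have hsub : ∀ z ∈ U, (-z).re ∈ interior (integrableExpSet id (laplaceMeasure α)) := by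
    intro z hz
    refine mem_interior.2 ⟨Set.Iio 0, fun r hr => ?_, isOpen_Iio, by simpa [hU] using hz⟩
    simpa [integrableExpSet] using integrable_exp_laplaceMeasure hα hr
  have h1 : AnalyticOnNhd ℂ (fun z => complexMGF id (laplaceMeasure α) (-z)) U := by
    refine DifferentiableOn.analyticOnNhd (fun z hz => ?_) hUo
    have := (hasDerivAt_complexMGF (hsub z hz)).differentiableAt
    exact (this.comp z differentiableAt_id.neg).differentiableWithinAt
  have h2 : AnalyticOnNhd ℂ (fun z : ℂ => z ^ (-(α : ℂ)) * Complex.Gamma α) U := by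
    refine DifferentiableOn.analyticOnNhd (fun z hz => ?_) hUo
    have : z ∈ slitPlane := Or.inl hz
    exact ((differentiableAt_id.cpow_const this).mul_const _).differentiableWithinAt
  have h3 : ∃ᶠ z in nhdsWithin (1 : ℂ) {1}ᶜ,
      complexMGF id (laplaceMeasure α) (-z) = z ^ (-(α : ℂ)) * Complex.Gamma α := by
    have ht : Filter.Tendsto (fun x : ℝ => (x : ℂ)) (nhdsWithin 1 {1}ᶜ) (nhdsWithin 1 {1}ᶜ) := by
      refine tendsto_nhdsWithin_iff.2 ⟨?_, ?_⟩
      · exact (Complex.continuous_ofReal.tendsto' 1 1 (by simp)).mono_left nhdsWithin_le_nhds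
      · filter_upwards [self_mem_nhdsWithin] with x hx
        simpa using hx
    refine ht.frequently (Filter.Eventually.frequently ?_)
    have : ∀ᶠ x : ℝ in nhdsWithin 1 {1}ᶜ, 0 < x :=
      nhdsWithin_le_nhds (lt_mem_nhds one_pos)
    filter_upwards [this] with x hx
    simpa [complexMGF] using integral_exp_laplaceMeasure hα hx
  have := h1.eqOn_of_preconnected_of_frequently_eq h2 hUc (z₀ := 1) (by simp [hU]) h3 hw
  simpa [complexMGF] using this

theorem kernel_eq_integral {α : ℝ} (hα : 0 < α) (z u : ℍ) :
    (Real.Gamma α : ℂ) * halfPlaneKernel α z u =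
      ∫ t : ℝ, cexp (I * z / 2 * t) * conj (cexp (I * u / 2 * t)) ∂(laplaceMeasure α) := by
  have hre : 0 < (((z : ℂ) - conj (u : ℂ)) / (2 * I)).re := by
    have hz := z.im_pos
    have hu := u.im_pos
    have : ((z : ℂ) - conj (u : ℂ)) / (2 * I) = -(I * (z - conj (u : ℂ)) / 2) := by
      field_simp; simp
    rw [this]
    simp
    linarith
  rw [halfPlaneKernel, ← Complex.Gamma_ofReal, mul_comm, ← complexMGF_laplaceMeasure hα hre]
  congr 1
  ext t
  rw [← Complex.exp_conj, ← Complex.exp_add]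
  congr 1
  simp only [neg_mul, map_mul, map_div₀, conj_I, map_ofNat, conj_ofReal]
  field_simp
  ring_nf
  simp only [I_sq]
  ring

theorem integrable_kernel {α : ℝ} (hα : 0 < α) (z u : ℍ) :
    Integrable (fun t : ℝ => cexp (I * z / 2 * t) * conj (cexp (I * u / 2 * t)))
      (laplaceMeasure α) := by
  have hz := z.im_pos
  have hu := u.im_pos
  refine (integrable_exp_laplaceMeasure hα (r := -(z.im + u.im) / 2) (by linarith)).mono'
    (by fun_prop) (Filter.Eventually.of_forall fun t => ?_)
  rw [← Complex.exp_conj, ← Complex.exp_add, Complex.norm_exp]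
  apply le_of_eq
  congr 1
  simp [map_ofNat]
  ring

/-- The kernel as an operator-valued matrix: the entry `(z, u)` is multiplication by `K(z, u)`. -/
def kernelMatrix (α : ℝ) : Matrix ℍ ℍ (ℂ →L[ℂ] ℂ) :=
  .of fun z u => halfPlaneKernel α z u • ContinuousLinearMap.id ℂ ℂ

theorem conj_halfPlaneKernel {α : ℝ} (hα : 0 < α) (z u : ℍ) :
    conj (halfPlaneKernel α z u) = halfPlaneKernel α u z := by
  have hG : (Real.Gamma α : ℂ) ≠ 0 := by exact_mod_cast (Real.Gamma_pos_of_pos hα).ne'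
  apply mul_left_cancel₀ hG
  rw [kernel_eq_integral hα, ← Complex.conj_ofReal, ← map_mul, kernel_eq_integral hα,
    ← integral_conj]
  simp [mul_comm]


theorem posSemidef_kernelMatrix {α : ℝ} (hα : 0 < α) : (kernelMatrix α).PosSemidef := by
  have hG := Real.Gamma_pos_of_pos hα
  have tf : (kernelMatrix α).PosSemidef ↔ (kernelMatrix α).IsHermitian ∧ ∀ v : ℍ →₀ ℂ,
      0 ≤ RCLike.re (v.sum fun x w => v.sum fun x' w' => inner ℂ (kernelMatrix α x' x w) w') :=
    RKHS.posSemidef_tfae.out 0 2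
  refine tf.2 ⟨?_, fun v => ?_⟩
  · ext z u
    simp [kernelMatrix, Matrix.conjTranspose_apply, conj_halfPlaneKernel hα,
      ContinuousLinearMap.star_eq_adjoint, ContinuousLinearMap.adjoint_id]
  · let e : ℍ → ℝ → ℂ := fun z t => cexp (I * z / 2 * t)
    let G : ℝ → ℂ := fun t => ∑ z ∈ v.support, conj (v z) * e z t
    have key : (Real.Gamma α : ℂ) * (v.sum fun x w => v.sum fun x' w' =>
        inner ℂ (kernelMatrix α x' x w) w') = ∫ t, G t * conj (G t) ∂(laplaceMeasure α) := by
      have hi : ∀ x y : ℍ, Integrable (fun t => conj (v x) * v y * (e x t * conj (e y t)))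
          (laplaceMeasure α) := fun x y => (integrable_kernel hα x y).const_mul _
      have hGG : ∀ t, G t * conj (G t) = ∑ x ∈ v.support, ∑ y ∈ v.support,
          conj (v x) * v y * (e x t * conj (e y t)) := by
        intro t
        simp only [G, map_sum, Finset.sum_mul_sum]
        refine Finset.sum_congr rfl fun x _ => Finset.sum_congr rfl fun y _ => ?_
        simp
        ring
      simp_rw [hGG]
      rw [integral_finsetSum _ fun x _ => integrable_finsetSum _ fun y _ => hi x y]
      simp only [Finsupp.sum, Finset.mul_sum]
      refine Finset.sum_congr rfl fun x _ => ?_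
      rw [integral_finsetSum _ fun y _ => hi x y]
      refine Finset.sum_congr rfl fun y _ => ?_
      rw [integral_const_mul, ← kernel_eq_integral hα]
      simp [kernelMatrix, conj_halfPlaneKernel hα]
      ring
    have h2 : ∫ t, G t * conj (G t) ∂(laplaceMeasure α) =
        ((∫ t, ‖G t‖ ^ 2 ∂(laplaceMeasure α) : ℝ) : ℂ) := by
      rw [← integral_complex_ofReal]
      congr 1
      ext t
      rw [Complex.mul_conj, Complex.normSq_eq_norm_sq]
    have h3 := congrArg Complex.re (key.trans h2)
    rw [Complex.re_ofReal_mul, Complex.ofReal_re] at h3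
    refine (mul_nonneg_iff_of_pos_left hG).1 ?_
    refine h3.symm ▸ integral_nonneg fun t => by positivity

instance fact_posSemidef_kernelMatrix (α : ℝ) [h : Fact (0 < α)] :
    Fact (kernelMatrix α).PosSemidef := ⟨posSemidef_kernelMatrix h.out⟩

/-- The space `H_α`: the reproducing kernel Hilbert space of functions on the upper half-plane with
kernel `K(z, u) = ((z - conj u) / (2i))^{-α}`. -/
def HighestWeightSpace (α : ℝ) [Fact (0 < α)] : Type := RKHS.OfKernel (kernelMatrix α)

instance HighestWeightSpace.normedAddCommGroup (α : ℝ) [Fact (0 < α)] :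
    NormedAddCommGroup (HighestWeightSpace α) :=
  inferInstanceAs (NormedAddCommGroup (RKHS.OfKernel (kernelMatrix α)))

instance HighestWeightSpace.innerProductSpace (α : ℝ) [Fact (0 < α)] :
    InnerProductSpace ℂ (HighestWeightSpace α) :=
  inferInstanceAs (InnerProductSpace ℂ (RKHS.OfKernel (kernelMatrix α)))

instance HighestWeightSpace.completeSpace (α : ℝ) [Fact (0 < α)] :
    CompleteSpace (HighestWeightSpace α) :=
  inferInstanceAs (CompleteSpace (RKHS.OfKernel (kernelMatrix α)))

instance HighestWeightSpace.rkhs (α : ℝ) [Fact (0 < α)] :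
    RKHS ℂ (HighestWeightSpace α) ℍ ℂ :=
  inferInstanceAs (RKHS ℂ (RKHS.OfKernel (kernelMatrix α)) ℍ ℂ)

theorem kernel_highestWeightSpace (α : ℝ) [Fact (0 < α)] :
    RKHS.kernel (HighestWeightSpace α) = kernelMatrix α :=
  RKHS.OfKernel.kernel_ofKernel

/-- The kernel functions of `H_α` are `Ψ_u(z) = K(z, u)`. -/
theorem kerFun_highestWeightSpace (α : ℝ) [Fact (0 < α)] (u z : ℍ) :
    RKHS.kerFun (HighestWeightSpace α) u 1 z = halfPlaneKernel α z u := by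
  rw [RKHS.kerFun_apply, kernel_highestWeightSpace]
  simp [kernelMatrix]

/-- The reproducing property `⟨F, Ψ_u⟩ = F(u)` (Mathlib's inner product is conjugate linear in the
first variable). -/
theorem reproducing (α : ℝ) [Fact (0 < α)] (F : HighestWeightSpace α) (u : ℍ) :
    inner ℂ (RKHS.kerFun (HighestWeightSpace α) u 1) F = F u := by
  simp

open Filter Topology in
/-- The elements of the space are holomorphic functions. -/
theorem holomorphic (α : ℝ) [Fact (0 < α)] (F : HighestWeightSpace α) :
    DifferentiableOn ℂ (fun z : ℂ => F (UpperHalfPlane.ofComplex z)) {z | 0 < z.im} := by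
  set S := Submodule.span ℂ {RKHS.kerFun (HighestWeightSpace α) x v | (x) (v)} with hS
  have hopen : IsOpen {z : ℂ | 0 < z.im} := isOpen_lt continuous_const Complex.continuous_im
  have hF : F ∈ closure (S : Set (HighestWeightSpace α)) := by
    have := RKHS.kerFun_dense (HighestWeightSpace α)
    rw [← Submodule.topologicalClosure_coe, hS, this]
    trivial
  obtain ⟨G, hGS, hG⟩ := mem_closure_iff_seq_limit.1 hF
  have hhol : ∀ H ∈ S, DifferentiableOn ℂ
      (fun z : ℂ => H (UpperHalfPlane.ofComplex z)) {z | 0 < z.im} := by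
    intro H hH
    induction hH using Submodule.span_induction with
    | mem x hx =>
      obtain ⟨u, v, rfl⟩ := hx
      have : DifferentiableOn ℂ
          (fun z : ℂ => (((z : ℂ) - conj (u : ℂ)) / (2 * I)) ^ (-(α : ℂ)) * v) {z | 0 < z.im} := by
        intro z hz
        have hz : 0 < z.im := hz
        have hu := u.im_pos
        have : (z - conj (u : ℂ)) / (2 * I) ∈ slitPlane := by
          left
          have : (z - conj (u : ℂ)) / (2 * I) = -(I * (z - conj (u : ℂ)) / 2) := by
            field_simp; simp
          rw [this]
          simp
          linarith
        refine DifferentiableAt.differentiableWithinAt ?_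
        exact (DifferentiableAt.cpow_const (f := fun z : ℂ => (z - conj (u : ℂ)) / (2 * I))
          ((differentiableAt_id.sub_const _).div_const _) this).mul_const v
      refine this.congr fun z hz => ?_
      rw [RKHS.kerFun_apply, kernel_highestWeightSpace]
      simp [kernelMatrix, halfPlaneKernel, UpperHalfPlane.ofComplex_apply_of_im_pos hz]
    | zero => simp
    | add x y _ _ hx hy => exact (hx.add hy).congr fun z _ => by simp
    | smul c x _ hx => exact (hx.const_smul c).congr fun z _ => by simp
  have hloc : TendstoLocallyUniformlyOn
      (fun n (z : ℂ) => G n (UpperHalfPlane.ofComplex z))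
      (fun z : ℂ => F (UpperHalfPlane.ofComplex z)) atTop {z | 0 < z.im} := by
    rw [tendstoLocallyUniformlyOn_iff_forall_isCompact hopen]
    intro K hK hKc
    have hcont : ContinuousOn (fun z : ℂ => (z.im : ℝ) ^ (-α)) K := fun z hz =>
      (Complex.continuous_im.continuousAt.rpow_const
        (Or.inl (hK hz).ne')).continuousWithinAt
    obtain ⟨C, hC⟩ := hKc.exists_bound_of_continuousOn hcont
    have hb : ∀ x ∈ {x : ℍ | (x : ℂ) ∈ K},
        ‖RKHS.kerFun (HighestWeightSpace α) x‖ ≤ √C := by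
      intro x hx
      rw [RKHS.norm_kerFun_eq_sqrt_norm_kernel, kernel_highestWeightSpace]
      refine Real.sqrt_le_sqrt ?_
      have h0 : ((x : ℂ) - conj (x : ℂ)) / (2 * I) = ((x.im : ℝ) : ℂ) := by
        rw [Complex.sub_conj]
        field_simp
        simp
      have h1 : kernelMatrix α x x =
          (((x.im ^ (-α) : ℝ)) : ℂ) • ContinuousLinearMap.id ℂ ℂ := by
        rw [kernelMatrix, Matrix.of_apply, halfPlaneKernel, h0, Complex.ofReal_cpow x.im_pos.le]
        simp
      rw [h1, norm_smul, Complex.norm_real, ContinuousLinearMap.norm_id, mul_one]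
      exact hC x hx
    have := RKHS.tendstoUniformlyOn_of_norm_kerFun_le hb hG
    rw [Metric.tendstoUniformlyOn_iff] at this ⊢
    intro ε hε
    filter_upwards [this ε hε] with n hn z hz
    exact hn _ (by simpa [UpperHalfPlane.ofComplex_apply_of_im_pos (hK hz)] using hz)
  exact hloc.differentiableOn (Eventually.of_forall fun n => hhol _ (hGS n)) hopen

/-- The point `(b + z d) / (a + z c)` of the half-plane, for `g = (a b; c d)`. -/
def moebius (g : Matrix.SpecialLinearGroup (Fin 2) ℝ) (z : ℍ) : ℍ :=
  ⟨((g 0 1 : ℂ) + z * g 1 1) / ((g 0 0 : ℂ) + z * g 1 0), by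
    have hd : g 0 0 * g 1 1 - g 0 1 * g 1 0 = 1 := by
      rw [← Matrix.det_fin_two]; exact g.2
    have hz := z.im_pos
    have hne : ((g 0 0 : ℂ) + z * g 1 0) ≠ 0 := by
      intro h
      have h1 := congrArg Complex.im h
      have h2 := congrArg Complex.re h
      simp at h1 h2
      rcases h1 with h1 | h1
      · exact hz.ne' h1
      · rw [h1] at h2 hd
        simp at h2 hd
        rw [h2] at hd
        simp at hd
    have hpos := Complex.normSq_pos.2 hne
    have : (((g 0 1 : ℂ) + z * g 1 1) / ((g 0 0 : ℂ) + z * g 1 0)).im =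
        z.im / Complex.normSq ((g 0 0 : ℂ) + z * g 1 0) := by
      rw [Complex.div_im, ← sub_div]
      congr 1
      simp
      linear_combination z.im * hd
    rw [this]
    positivity⟩

/-- `T_α(g) F(z) = F((b + z d)/(a + z c)) (a + z c)^{-α}`, with the principal branch of the power
(on the half-plane `a + z c` is a constant or stays off the real line). -/
def highestWeightAction (α : ℝ) (g : Matrix.SpecialLinearGroup (Fin 2) ℝ) (F : ℍ → ℂ) : ℍ → ℂ :=
  fun z => F (moebius g z) * ((g 0 0 : ℂ) + z * g 1 0) ^ (-(α : ℂ))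

/-- `D(a) = diag(a^{1/2}, a^{-1/2})`. -/
def diagonalElement (a : ℝ) (ha : 0 < a) : Matrix.SpecialLinearGroup (Fin 2) ℝ :=
  ⟨!![√a, 0; 0, (√a)⁻¹], by
    simp [Matrix.det_fin_two, (Real.sqrt_pos.2 ha).ne']⟩

/-- The diagonal subgroup acts by `F(z) ↦ F(a⁻¹ z) a^{-α/2}`. -/
theorem highestWeightAction_diagonalElement (α : ℝ) (a : ℝ) (ha : 0 < a) (F : ℍ → ℂ) (z : ℍ) :
    highestWeightAction α (diagonalElement a ha) F z =
      F ⟨(a⁻¹ : ℝ) * z, by simpa using mul_pos (inv_pos.2 ha) z.im_pos⟩ *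
        ((a ^ (-α / 2) : ℝ) : ℂ) := by
  have hs : (√a : ℂ) * √a = a := by exact_mod_cast Real.mul_self_sqrt ha.le
  have hs0 : (√a : ℂ) ≠ 0 := by exact_mod_cast (Real.sqrt_pos.2 ha).ne'
  rw [highestWeightAction]
  congr 1
  · congr 1
    apply UpperHalfPlane.ext
    simp [moebius, diagonalElement]
    rw [← hs]
    field_simp
  · have : (√a) ^ (-α) = a ^ (-α / 2) := by
      rw [Real.sqrt_eq_rpow, ← Real.rpow_mul ha.le]
      congr 1
      ring
    rw [← this, Complex.ofReal_cpow (Real.sqrt_nonneg a)]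
    simp [diagonalElement]

/-- The measure `|Γ(α/2 + is)|² ds / (2π Γ(α))` on the line. -/
def spectralMeasure (α : ℝ) : Measure ℝ :=
  volume.withDensity fun s : ℝ =>
    ENNReal.ofReal (‖Complex.Gamma (α / 2 + I * s)‖ ^ 2 / (2 * Real.pi * Real.Gamma α))

theorem memLp_spectralAction (α a : ℝ) (ha : 0 < a) (f : Lp ℂ 2 (spectralMeasure α)) :
    MemLp (fun s : ℝ => f s * (a : ℂ) ^ (I * (s : ℂ))) 2 (spectralMeasure α) := by
  refine (Lp.memLp f).of_le ((Lp.aestronglyMeasurable f).mul ?_)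
    (Filter.Eventually.of_forall fun s => ?_)
  · refine Continuous.aestronglyMeasurable ?_
    exact Continuous.const_cpow (by fun_prop) (Or.inl (by exact_mod_cast ha.ne'))
  · rw [norm_mul, Complex.norm_cpow_eq_rpow_re_of_pos ha]
    simp

/-- The action of `D(a)` on `L²` of the spectral measure: `f(s) ↦ f(s) a^{is}`. -/
def spectralAction (α a : ℝ) (ha : 0 < a) (f : Lp ℂ 2 (spectralMeasure α)) :
    Lp ℂ 2 (spectralMeasure α) :=
  (memLp_spectralAction α a ha f).toLp

/-- The integrand `f(s) (z/i)^{-α/2-is} |Γ(α/2 + is)|²`. As `Re (z/i) > 0`, the principal branch is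
the one for which `ln (z/i)` is real on the imaginary half-axis. -/
def mellinIntegrand (α : ℝ) (f : ℝ → ℂ) (z : ℍ) (s : ℝ) : ℂ :=
  f s * ((z : ℂ) / I) ^ (-(α / 2 : ℂ) - I * s) * (‖Complex.Gamma (α / 2 + I * s)‖ ^ 2 : ℝ)

/-- `J_α f(z) = 2^{α/2} / (2π Γ(α)) * ∫ f(s) (z/i)^{-α/2-is} |Γ(α/2 + is)|² ds`. -/
def twistedMellin (α : ℝ) (f : ℝ → ℂ) (z : ℍ) : ℂ :=
  ((2 ^ (α / 2) / (2 * Real.pi * Real.Gamma α) : ℝ) : ℂ) * ∫ s : ℝ, mellinIntegrand α f z s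

end VilenkinMellin

end

/-! ### Unitary operators from Gram matrices. -/

namespace VilenkinMellin

open MeasureTheory FourierTransform
open scoped ComplexConjugate ContDiff SchwartzMap

/-! For fixed `z`, the number `J_α f(z)` is the inner product of `f` with an explicit function
`e_z`, the conjugate of `2^{α/2} (z/i)^{-α/2-is}`. If the `e_z` lie in `L²(μ)`, are total there, and
satisfy `⟨e_z, e_u⟩ = K(z, u)`, then they have the same Gram matrix as the kernel functions `Ψ_z` of
`H_α`, which are also total. Hence `e_z ↦ Ψ_z` extends to a unitary `J`, and `J f(z) = ⟨Ψ_z, J f⟩ =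
⟨e_z, f⟩` is the given integral.

The Gram matrix (`integral_conj_evalFunction_mul`) is Plancherel's theorem. In the variable `t =
e^{-u}`, the function `p^{-σ-is} Γ(σ+is)` is the Fourier transform of `t^σ e^{-pt}`, and the product
of two such profiles, one conjugated, is again one of them; its integral is a Gamma integral that
gives the kernel.

Totality (`eq_zero_of_twistedMellin_eq_zero`) is injectivity of the Fourier transform on `L¹`: on
the imaginary half-axis `J_α f` is, up to a nonvanishing factor, the Fourier transform of `f
|Γ(α/2+is)|²`. The intertwining relation is homogeneity of the power `(z/i)^{-α/2-is}`. -/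

theorem denseRange_linearCombination {ι G : Type*} [NormedAddCommGroup G] [InnerProductSpace ℂ G]
    {x : ι → G} (hx : (Submodule.span ℂ (Set.range x)).topologicalClosure = ⊤) :
    DenseRange (Finsupp.linearCombination ℂ x) := by
  rw [DenseRange, ← LinearMap.coe_range, Finsupp.range_linearCombination]
  exact Submodule.dense_iff_topologicalClosure_eq_top.2 hx

/-- Two total families with the same Gram matrix are related by a unitary operator. -/
theorem exists_linearIsometryEquiv_of_inner_eq {ι E F : Type*}
    [NormedAddCommGroup E] [InnerProductSpace ℂ E] [CompleteSpace E]
    [NormedAddCommGroup F] [InnerProductSpace ℂ F] [CompleteSpace F]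
    (v : ι → E) (w : ι → F)
    (hv : (Submodule.span ℂ (Set.range v)).topologicalClosure = ⊤)
    (hw : (Submodule.span ℂ (Set.range w)).topologicalClosure = ⊤)
    (h : ∀ i j, inner ℂ (v i) (v j) = inner ℂ (w i) (w j)) :
    ∃ e : E ≃ₗᵢ[ℂ] F, ∀ i, e (v i) = w i := by
  have hn : ∀ c : ι →₀ ℂ, ‖Finsupp.linearCombination ℂ w c‖ =
      ‖Finsupp.linearCombination ℂ v c‖ := by
    intro c
    rw [@norm_eq_sqrt_re_inner ℂ, @norm_eq_sqrt_re_inner ℂ]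
    congr 2
    -- Both squared norms are the same quadratic form in the coefficients, given by the common Gram
    -- matrix.
    simp only [Finsupp.linearCombination_apply, Finsupp.sum, sum_inner, inner_sum,
      inner_smul_left, inner_smul_right, h]
  refine ⟨(LinearEquiv.refl ℂ (ι →₀ ℂ)).extendOfIsometry _ _ (denseRange_linearCombination hv)
    (denseRange_linearCombination hw) hn, fun i => ?_⟩
  have := LinearEquiv.extendOfIsometry_eq (LinearEquiv.refl ℂ (ι →₀ ℂ)) _ _
    (denseRange_linearCombination hv)
    (denseRange_linearCombination hw) hn (Finsupp.single i 1)
  simpa using this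

/-! ### Fourier transform on `L¹` and `L¹ ∩ L²`. -/

/-- The Fourier transform is self-adjoint for the bilinear pairing of integrable functions. -/
theorem integral_fourier_mul_eq_integral_mul_fourier {f g : ℝ → ℂ}
    (hf : Integrable f) (hg : Integrable g) :
    ∫ ξ, 𝓕 f ξ * g ξ = ∫ x, f x * 𝓕 g x := by
  simpa using! VectorFourier.integral_fourierIntegral_smul_eq_flip (L := innerₗ ℝ)
      Real.continuous_fourierChar continuous_inner hf hg

/-- The Fourier transform is injective on `L¹`. -/
theorem ae_eq_zero_of_fourier_eq_zero {f : ℝ → ℂ} (hf : Integrable f) (h : ∀ ξ, 𝓕 f ξ = 0) :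
    ∀ᵐ x, f x = 0 := by
  refine ae_eq_zero_of_integral_contDiff_smul_eq_zero hf.locallyIntegrable fun g hg hgc => ?_
  have hg₁ : HasCompactSupport (Complex.ofRealCLM ∘ g) := hgc.comp_left rfl
  have hg₂ : ContDiff ℝ ∞ (Complex.ofRealCLM ∘ g) := by fun_prop
  let φ : 𝓢(ℝ, ℂ) := hg₁.toSchwartzMap hg₂
  -- The test function is itself a Fourier transform, so its pairing with `f` moves onto `𝓕 f = 0`.
  have h1 := integral_fourier_mul_eq_integral_mul_fourier hf (𝓕⁻ φ).integrable
  rw [← SchwartzMap.fourier_coe, fourier_fourierInv_eq] at h1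
  simp only [h, zero_mul, integral_zero] at h1
  rw [h1]
  refine integral_congr_ae (Filter.Eventually.of_forall fun x => ?_)
  simp [φ, mul_comm]

/-- On `L¹ ∩ L²` the `L²` Fourier transform is given by the Fourier integral. -/
theorem fourier_toLp_ae_eq {f : ℝ → ℂ} (hf : Integrable f) (hf2 : MemLp f 2) :
    (𝓕 (hf2.toLp f) : Lp ℂ 2 (volume : Measure ℝ)) =ᵐ[volume] 𝓕 f := by
  have hc : Continuous (𝓕 f) := by
    exact VectorFourier.fourierIntegral_continuous Real.continuous_fourierChar
      continuous_inner hf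
  -- Both transforms have the same pairing with a test function: the `L²` one by the distributional
  -- definition, the integral one by self-adjointness.
  refine ae_eq_of_integral_contDiff_smul_eq ((Lp.memLp _).locallyIntegrable (by norm_num))
    hc.locallyIntegrable fun g hg hgc => ?_
  have hg₁ : HasCompactSupport (Complex.ofRealCLM ∘ g) := hgc.comp_left rfl
  have hg₂ : ContDiff ℝ ∞ (Complex.ofRealCLM ∘ g) := by fun_prop
  let φ : 𝓢(ℝ, ℂ) := hg₁.toSchwartzMap hg₂
  have h1 := integral_fourier_mul_eq_integral_mul_fourier hf φ.integrable
  have h2 := congrArg (fun T : 𝓢'(ℝ, ℂ) => T φ)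
    (Lp.fourier_toTemperedDistribution_eq (hf2.toLp f))
  simp only [TemperedDistribution.fourier_apply, Lp.toTemperedDistribution_apply] at h2
  calc _ = ∫ x, φ x • (𝓕 (hf2.toLp f) : Lp ℂ 2 (volume : Measure ℝ)) x := by simp [φ]
    _ = ∫ x, (𝓕 φ) x • (hf2.toLp f : Lp ℂ 2 (volume : Measure ℝ)) x := h2.symm
    _ = ∫ x, f x * 𝓕 (φ : ℝ → ℂ) x := by
      refine integral_congr_ae ?_
      filter_upwards [hf2.coeFn_toLp] with x hx
      rw [hx, ← SchwartzMap.fourier_coe, smul_eq_mul, mul_comm]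
    _ = _ := by
      rw [← h1]
      simp [φ, mul_comm]

theorem memLp_fourier {f : ℝ → ℂ} (hf : Integrable f) (hf2 : MemLp f 2) : MemLp (𝓕 f) 2 :=
  (memLp_congr_ae (fourier_toLp_ae_eq hf hf2)).1 (Lp.memLp _)

/-- Plancherel's theorem on `L¹ ∩ L²`. -/
theorem integral_conj_fourier_mul_fourier {f g : ℝ → ℂ} (hf : Integrable f) (hf2 : MemLp f 2)
    (hg : Integrable g) (hg2 : MemLp g 2) :
    ∫ ξ, conj (𝓕 f ξ) * 𝓕 g ξ = ∫ x, conj (f x) * g x := by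
  have h := Lp.inner_fourier_eq (hf2.toLp f) (hg2.toLp g)
  rw [L2.inner_def, L2.inner_def] at h
  convert h using 1
  · refine integral_congr_ae ?_
    filter_upwards [fourier_toLp_ae_eq hf hf2, fourier_toLp_ae_eq hg hg2] with x hx hy
    rw [hx, hy]; simp [mul_comm]
  · refine integral_congr_ae ?_
    filter_upwards [hf2.coeFn_toLp, hg2.coeFn_toLp] with x hx hy
    rw [hx, hy]; simp [mul_comm]

end VilenkinMellin

/-! ### Gamma integrals and Plancherel's theorem for them. -/

namespace VilenkinMellin

open MeasureTheory FourierTransform Filter Topology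
open scoped ComplexConjugate

theorem integrableOn_rpow_mul_exp_neg_mul {σ c : ℝ} (hσ : 0 < σ) (hc : 0 < c) :
    IntegrableOn (fun t : ℝ => t ^ (σ - 1) * Real.exp (-(c * t))) (Set.Ioi 0) := by
  have h := integrableOn_rpow_mul_exp_neg_mul_rpow (s := σ - 1) (p := 1) (b := c)
    (by linarith) one_pos hc
  simpa using h

theorem aestronglyMeasurable_cpow_mul_cexp (a r : ℂ) :
    AEStronglyMeasurable (fun t : ℝ => (t : ℂ) ^ (a - 1) * Complex.exp (-(r * t)))
      (volume.restrict (Set.Ioi 0)) :=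
  (by fun_prop : Measurable _).aestronglyMeasurable

theorem norm_cpow_mul_cexp (a r : ℂ) {t : ℝ} (ht : 0 < t) :
    ‖(t : ℂ) ^ (a - 1) * Complex.exp (-(r * t))‖ = t ^ (a.re - 1) * Real.exp (-(r.re * t)) := by
  rw [norm_mul, Complex.norm_cpow_eq_rpow_re_of_pos ht, Complex.norm_exp]
  simp

theorem integrableOn_cpow_mul_cexp {a r : ℂ} (ha : 0 < a.re) (hr : 0 < r.re) :
    IntegrableOn (fun t : ℝ => (t : ℂ) ^ (a - 1) * Complex.exp (-(r * t))) (Set.Ioi 0) := by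
  refine (integrableOn_rpow_mul_exp_neg_mul ha hr).mono' (aestronglyMeasurable_cpow_mul_cexp a r) ?_
  filter_upwards [self_mem_ae_restrict measurableSet_Ioi] with t ht
  rw [norm_cpow_mul_cexp a r ht]

/-- Holomorphy in the scale `r` allows the Gamma integral to be continued from real to complex `r`.
-/
theorem differentiableAt_integral_cpow_mul_cexp {a r : ℂ} (ha : 0 < a.re) (hr : 0 < r.re) :
    DifferentiableAt ℂ
      (fun r : ℂ => ∫ t : ℝ in Set.Ioi 0, (t : ℂ) ^ (a - 1) * Complex.exp (-(r * t))) r := by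
  -- On this neighbourhood the exponential is dominated by `e^{-(Re r / 2) t}`; the derivative
  -- brings a factor `t`, hence the exponent `a.re + 1 - 1` in the bound.
  have hs : {w : ℂ | r.re / 2 < w.re} ∈ 𝓝 r :=
    (isOpen_lt continuous_const Complex.continuous_re).mem_nhds
      (by simp only [Set.mem_ofPred_eq]; linarith)
  have h := hasDerivAt_integral_of_dominated_loc_of_deriv_le (𝕜 := ℂ)
    (μ := volume.restrict (Set.Ioi (0 : ℝ)))
    (F := fun r t => (t : ℂ) ^ (a - 1) * Complex.exp (-(r * t)))
    (F' := fun r t => (t : ℂ) ^ (a - 1) * (Complex.exp (-(r * t)) * -t))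
    (bound := fun t => t ^ (a.re + 1 - 1) * Real.exp (-(r.re / 2 * t))) hs
    (Eventually.of_forall fun x => aestronglyMeasurable_cpow_mul_cexp a x)
    (integrableOn_cpow_mul_cexp ha hr) (by fun_prop : Measurable _).aestronglyMeasurable ?_
    (integrableOn_rpow_mul_exp_neg_mul (by linarith) (by linarith)) ?_
  · exact h.2.differentiableAt
  · filter_upwards [self_mem_ae_restrict measurableSet_Ioi] with t ht w hw
    have ht : 0 < t := ht
    have hw : r.re / 2 < w.re := hw
    rw [← mul_assoc, norm_mul, norm_cpow_mul_cexp a w ht, norm_neg, Complex.norm_real,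
      Real.norm_of_nonneg ht.le, add_sub_right_comm, Real.rpow_add_one ht.ne', mul_right_comm]
    gcongr
  · refine Eventually.of_forall fun t w _ => ?_
    have h1 : HasDerivAt (fun w : ℂ => -(w * t)) (-t : ℂ) w := by
      simpa using! ((hasDerivAt_id w).mul_const (t : ℂ)).neg
    exact h1.cexp.const_mul _

/-- The Gamma integral with a complex scale parameter. -/
theorem integral_cpow_mul_cexp {a r : ℂ} (ha : 0 < a.re) (hr : 0 < r.re) :
    ∫ t : ℝ in Set.Ioi 0, (t : ℂ) ^ (a - 1) * Complex.exp (-(r * t)) =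
      r ^ (-a) * Complex.Gamma a := by
  set U : Set ℂ := {z | 0 < z.re} with hU
  have hUo : IsOpen U := isOpen_lt continuous_const Complex.continuous_re
  have hUc : IsPreconnected U := (convex_halfSpace_re_gt 0).isPreconnected
  have h1 : AnalyticOnNhd ℂ (fun r : ℂ => ∫ t : ℝ in Set.Ioi 0,
      (t : ℂ) ^ (a - 1) * Complex.exp (-(r * t))) U :=
    DifferentiableOn.analyticOnNhd (fun z hz =>
      (differentiableAt_integral_cpow_mul_cexp ha hz).differentiableWithinAt) hUo
  have h2 : AnalyticOnNhd ℂ (fun z : ℂ => z ^ (-a) * Complex.Gamma a) U := by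
    refine DifferentiableOn.analyticOnNhd (fun z hz => ?_) hUo
    have : z ∈ Complex.slitPlane := Or.inl hz
    exact ((differentiableAt_id.cpow_const this).mul_const _).differentiableWithinAt
  -- The formula is known for positive real scales, which accumulate at `1`; the identity theorem
  -- does the rest.
  have h3 : ∃ᶠ z in 𝓝[≠] (1 : ℂ), ∫ t : ℝ in Set.Ioi 0,
      (t : ℂ) ^ (a - 1) * Complex.exp (-(z * t)) = z ^ (-a) * Complex.Gamma a := by
    have ht : Tendsto (fun x : ℝ => (x : ℂ)) (𝓝[≠] 1) (𝓝[≠] 1) := by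
      refine tendsto_nhdsWithin_iff.2 ⟨?_, ?_⟩
      · exact (Complex.continuous_ofReal.tendsto' 1 1 (by simp)).mono_left nhdsWithin_le_nhds
      · filter_upwards [self_mem_nhdsWithin] with x hx
        simpa using hx
    refine ht.frequently (Eventually.frequently ?_)
    filter_upwards [nhdsWithin_le_nhds (lt_mem_nhds one_pos)] with x hx
    rw [Complex.integral_cpow_mul_exp_neg_mul_Ioi ha hx, one_div, Complex.inv_cpow _ _
      (by simp [Complex.arg_ofReal_of_nonneg hx.le, Real.pi_ne_zero.symm]), ← Complex.cpow_neg]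
  exact h1.eqOn_of_preconnected_of_frequently_eq h2 hUc (z₀ := 1) (by simp [hU]) h3 hr

/-- `t^σ e^{-pt}` in the logarithmic variable `t = e^{-u}`. -/
noncomputable def gammaProfile (σ : ℝ) (p : ℂ) (u : ℝ) : ℂ :=
  Real.exp (-σ * u) • Complex.exp (-(p * Real.exp (-u)))

theorem continuous_gammaProfile (σ : ℝ) (p : ℂ) : Continuous (gammaProfile σ p) := by
  unfold gammaProfile
  fun_prop

theorem norm_gammaProfile (σ : ℝ) (p : ℂ) (u : ℝ) :
    ‖gammaProfile σ p u‖ = Real.exp (-σ * u) * Real.exp (-(p.re * Real.exp (-u))) := by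
  rw [gammaProfile, norm_smul, Complex.norm_exp, Real.norm_of_nonneg (Real.exp_pos _).le,
    Complex.neg_re, Complex.re_mul_ofReal]

/-- The substitution `t = e^{-u}` reduces this to the Gamma integrand on `(0, ∞)`. -/
theorem integrable_exp_mul_exp {σ c : ℝ} (hσ : 0 < σ) (hc : 0 < c) :
    Integrable fun u : ℝ => Real.exp (-σ * u) * Real.exp (-(c * Real.exp (-u))) := by
  have hi : (fun u : ℝ => Real.exp (-u)) '' Set.univ = Set.Ioi 0 := by
    rw [Set.image_univ, ← Real.range_exp]
    exact neg_surjective.range_comp Real.exp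
  have hd : ∀ x ∈ Set.univ, HasDerivWithinAt (fun u : ℝ => Real.exp (-u)) (-Real.exp (-x))
      Set.univ x := fun x _ => by
    simpa using (hasDerivAt_neg x).exp
  have h := integrableOn_rpow_mul_exp_neg_mul hσ hc
  rw [← hi, integrableOn_image_iff_integrableOn_abs_deriv_smul MeasurableSet.univ hd
    (Real.exp_injective.comp neg_injective).injOn, integrableOn_univ] at h
  refine h.congr (Eventually.of_forall fun u => ?_)
  simp only [abs_neg, Real.abs_exp, smul_eq_mul]
  rw [← mul_assoc, ← Real.exp_mul, ← Real.exp_add]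
  ring_nf

theorem integrable_gammaProfile {σ : ℝ} {p : ℂ} (hσ : 0 < σ) (hp : 0 < p.re) :
    Integrable (gammaProfile σ p) :=
  (integrable_exp_mul_exp hσ hp).mono' (continuous_gammaProfile σ p).aestronglyMeasurable
    (Eventually.of_forall fun u => (norm_gammaProfile σ p u).le)

theorem memLp_gammaProfile {σ : ℝ} {p : ℂ} (hσ : 0 < σ) (hp : 0 < p.re) :
    MemLp (gammaProfile σ p) 2 := by
  rw [memLp_two_iff_integrable_sq_norm (continuous_gammaProfile σ p).aestronglyMeasurable]
  refine (integrable_exp_mul_exp (σ := 2 * σ) (c := 2 * p.re)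
    (by linarith) (by linarith)).congr (Eventually.of_forall fun u => ?_)
  simp only [norm_gammaProfile, mul_pow, ← Real.exp_nat_mul]
  congr 2 <;> push_cast <;> ring

/-- A Mellin transform is a Fourier transform in the logarithmic variable, at frequency `Im s / 2π`.
-/
theorem fourier_gammaProfile {p s : ℂ} (hs : 0 < s.re) (hp : 0 < p.re) :
    𝓕 (gammaProfile s.re p) (s.im / (2 * Real.pi)) = p ^ (-s) * Complex.Gamma s := by
  have h := mellin_eq_fourier (fun t : ℝ => Complex.exp (-(p * t))) (s := s)
  rw [← integral_cpow_mul_cexp hs hp]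
  exact h.symm

/-- The profiles are closed under this product, so the right side of Plancherel's identity is again
a Gamma integral. -/
theorem conj_gammaProfile_mul (σ : ℝ) (p q : ℂ) (u : ℝ) :
    conj (gammaProfile σ p u) * gammaProfile σ q u = gammaProfile (2 * σ) (conj p + q) u := by
  simp only [gammaProfile, Complex.real_smul, ← Complex.exp_conj, Complex.ofReal_exp,
    ← Complex.exp_add]
  simp [← Complex.exp_conj]
  ring_nf

theorem integral_gammaProfile {σ : ℝ} {p : ℂ} (hσ : 0 < σ) (hp : 0 < p.re) :
    ∫ u, gammaProfile σ p u = p ^ (-(σ : ℂ)) * Complex.Gamma σ := by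
  -- The integral is the Fourier transform at frequency `0`, that is, at real `s`.
  rw [← fourier_gammaProfile (s := σ) (by simpa using hσ) hp]
  simp [Real.fourier_real_eq]

/-- `Γ(σ + is) p^{-σ-is}` as a function of `s`. -/
noncomputable def gammaMellin (σ : ℝ) (p : ℂ) (s : ℝ) : ℂ :=
  p ^ (-(σ + Complex.I * s : ℂ)) * Complex.Gamma (σ + Complex.I * s)

theorem fourier_gammaProfile_div {σ : ℝ} {p : ℂ} (hσ : 0 < σ) (hp : 0 < p.re) (s : ℝ) :
    𝓕 (gammaProfile σ p) (s / (2 * Real.pi)) = gammaMellin σ p s := by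
  simpa [gammaMellin, neg_add, add_comm] using fourier_gammaProfile (p := p) (s := σ + Complex.I * s) (by simpa using hσ) hp

theorem memLp_gammaMellin {σ : ℝ} {p : ℂ} (hσ : 0 < σ) (hp : 0 < p.re) :
    MemLp (gammaMellin σ p) 2 := by
  have h := memLp_fourier (integrable_gammaProfile hσ hp) (memLp_gammaProfile hσ hp)
  have hfun : gammaMellin σ p = fun s => 𝓕 (gammaProfile σ p) (s / (2 * Real.pi)) :=
    funext fun s => (fourier_gammaProfile_div hσ hp s).symm
  rw [hfun]
  have hc : Continuous (𝓕 (gammaProfile σ p)) :=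
    VectorFourier.fourierIntegral_continuous Real.continuous_fourierChar
      continuous_inner (integrable_gammaProfile hσ hp)
  rw [memLp_two_iff_integrable_sq_norm hc.aestronglyMeasurable] at h
  rw [memLp_two_iff_integrable_sq_norm (by fun_prop)]
  exact h.comp_div Real.two_pi_pos.ne'

/-- Plancherel's theorem for `Γ(σ + is) p^{-σ-is}`. -/
theorem integral_conj_gammaMellin_mul {σ : ℝ} {p q : ℂ} (hσ : 0 < σ) (hp : 0 < p.re)
    (hq : 0 < q.re) :
    ∫ s, conj (gammaMellin σ p s) * gammaMellin σ q s =
      2 * Real.pi * ((conj p + q) ^ (-((2 * σ : ℝ) : ℂ)) * Complex.Gamma ((2 * σ : ℝ) : ℂ)) := by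
  have h := integral_conj_fourier_mul_fourier (integrable_gammaProfile hσ hp)
    (memLp_gammaProfile hσ hp) (integrable_gammaProfile hσ hq) (memLp_gammaProfile hσ hq)
  simp only [conj_gammaProfile_mul] at h
  rw [integral_gammaProfile (by linarith) (by simp; linarith)] at h
  rw [← h]
  -- Passing from the frequency `ξ` to `s = 2πξ` produces the factor `2π`.
  have h2 := Measure.integral_comp_div
    (fun ξ => conj (𝓕 (gammaProfile σ p) ξ) * 𝓕 (gammaProfile σ q) ξ) (2 * Real.pi)
  simp only [fourier_gammaProfile_div hσ hp, fourier_gammaProfile_div hσ hq,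
    abs_of_pos Real.two_pi_pos] at h2
  rw [h2]
  simp

end VilenkinMellin

/-! ### Evaluation functions, totality and the intertwining relation. -/

namespace VilenkinMellin

open MeasureTheory FourierTransform Filter Topology
open scoped ComplexConjugate UpperHalfPlane

/-- A positive factor does not change the argument, so the principal logarithm splits. This serves
for the factor `2` in the kernel and for the dilation `a⁻¹`. -/
theorem ofReal_mul_cpow {r : ℝ} (hr : 0 < r) {v : ℂ} (hv : v ≠ 0) (c : ℂ) :
    ((r : ℂ) * v) ^ c = (r : ℂ) ^ c * v ^ c := by
  have hr' : (r : ℂ) ≠ 0 := by exact_mod_cast hr.ne'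
  rw [Complex.cpow_def_of_ne_zero (mul_ne_zero hr' hv), Complex.cpow_def_of_ne_zero hr',
    Complex.cpow_def_of_ne_zero hv, Complex.log_ofReal_mul hr hv, Complex.ofReal_log hr.le,
    add_mul, Complex.exp_add]

theorem re_div_I_pos (z : ℍ) : 0 < ((z : ℂ) / Complex.I).re := by
  simpa [Complex.div_I] using z.im_pos

theorem div_I_ne_zero (z : ℍ) : (z : ℂ) / Complex.I ≠ 0 := fun h => by
  simpa [h] using re_div_I_pos z

/-- The density of the spectral measure. -/
noncomputable def spectralDensity (α s : ℝ) : ℝ :=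
  ‖Complex.Gamma (α / 2 + Complex.I * s)‖ ^ 2 / (2 * Real.pi * Real.Gamma α)

theorem spectralDensity_pos {α : ℝ} (hα : 0 < α) (s : ℝ) : 0 < spectralDensity α s := by
  have h := Complex.Gamma_ne_zero_of_re_pos (s := α / 2 + Complex.I * s) (by simpa using hα)
  have := Real.Gamma_pos_of_pos hα
  have := norm_pos_iff.2 h
  unfold spectralDensity
  positivity

theorem continuous_spectralDensity {α : ℝ} (hα : 0 < α) : Continuous (spectralDensity α) := by
  have h : Continuous fun s : ℝ => Complex.Gamma (α / 2 + Complex.I * s) := by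
    refine continuous_iff_continuousAt.2 fun s => ?_
    refine ContinuousAt.comp (g := Complex.Gamma) ?_ (by fun_prop)
    refine (Complex.differentiableAt_Gamma _ fun m hm => ?_).continuousAt
    have := congrArg Complex.re hm
    simp at this
    have h0 : (0 : ℝ) ≤ m := m.cast_nonneg
    linarith
  unfold spectralDensity
  fun_prop

theorem integral_spectralMeasure {α : ℝ} (hα : 0 < α) (g : ℝ → ℂ) :
    ∫ s, g s ∂(spectralMeasure α) = ∫ s, (spectralDensity α s : ℂ) * g s := by
  have hm : Measurable fun s => ENNReal.ofReal (spectralDensity α s) :=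
    (continuous_spectralDensity hα).measurable.ennreal_ofReal
  change ∫ s, g s ∂(volume.withDensity fun s => ENNReal.ofReal (spectralDensity α s)) = _
  rw [integral_withDensity_eq_integral_toReal_smul hm (by simp)]
  simp [ENNReal.toReal_ofReal (spectralDensity_pos hα _).le]

theorem integrable_spectralMeasure_iff {α : ℝ} (hα : 0 < α) {E : Type*} [NormedAddCommGroup E]
    [NormedSpace ℝ E] (g : ℝ → E) :
    Integrable g (spectralMeasure α) ↔ Integrable fun s => spectralDensity α s • g s := by
  have hm : Measurable fun s => ENNReal.ofReal (spectralDensity α s) :=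
    (continuous_spectralDensity hα).measurable.ennreal_ofReal
  change Integrable g (volume.withDensity fun s => ENNReal.ofReal (spectralDensity α s)) ↔ _
  rw [integrable_withDensity_iff_integrable_smul' hm (by simp)]
  simp [ENNReal.toReal_ofReal (spectralDensity_pos hα _).le]

/-- The function representing evaluation of the transform at `z`. -/
noncomputable def evalFunction (α : ℝ) (z : ℍ) (s : ℝ) : ℂ :=
  conj (((2 ^ (α / 2) : ℝ) : ℂ) * ((z : ℂ) / Complex.I) ^ (-(α / 2 : ℂ) - Complex.I * s))

theorem continuous_evalFunction (α : ℝ) (z : ℍ) : Continuous (evalFunction α z) := by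
  have : Continuous fun s : ℝ => ((z : ℂ) / Complex.I) ^ (-(α / 2 : ℂ) - Complex.I * s) :=
    Continuous.const_cpow (by fun_prop) (Or.inl (div_I_ne_zero z))
  unfold evalFunction
  fun_prop

theorem two_rpow_mul_gammaMellin (α : ℝ) (z : ℍ) (s : ℝ) :
    ((2 ^ (α / 2) : ℝ) : ℂ) * gammaMellin (α / 2) ((z : ℂ) / Complex.I) s =
      conj (evalFunction α z s) * Complex.Gamma (α / 2 + Complex.I * s) := by
  simp only [evalFunction, gammaMellin, Complex.conj_conj]
  push_cast
  rw [neg_add, ← sub_eq_add_neg, mul_assoc]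

/-- The weight `|Γ|² = Γ · conj Γ` is shared out, one Gamma factor to each power; this turns the
`L²(μ)` pairing into one for Lebesgue measure. -/
theorem spectralDensity_mul_evalFunction (α : ℝ) (z u : ℍ) (s : ℝ) :
    (spectralDensity α s : ℂ) * (conj (evalFunction α z s) * evalFunction α u s) =
      ((2 ^ α / (2 * Real.pi * Real.Gamma α) : ℝ) : ℂ) *
        (conj (gammaMellin (α / 2) ((u : ℂ) / Complex.I) s) *
          gammaMellin (α / 2) ((z : ℂ) / Complex.I) s) := by
  have h1 := two_rpow_mul_gammaMellin α z s
  have h2 := congrArg conj (two_rpow_mul_gammaMellin α u s)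
  have h3 : ((2 ^ α : ℝ) : ℂ) = ((2 ^ (α / 2) : ℝ) : ℂ) * ((2 ^ (α / 2) : ℝ) : ℂ) := by
    rw [← Complex.ofReal_mul, ← Real.rpow_add two_pos, add_halves]
  simp only [map_mul, Complex.conj_ofReal, Complex.conj_conj] at h2
  have h4 : ((‖Complex.Gamma (α / 2 + Complex.I * s)‖ : ℂ)) ^ 2 =
      Complex.Gamma (α / 2 + Complex.I * s) * conj (Complex.Gamma (α / 2 + Complex.I * s)) := by
    rw [Complex.mul_conj, Complex.normSq_eq_norm_sq]; push_cast; rfl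
  rw [spectralDensity, Complex.ofReal_div, Complex.ofReal_div, h3, Complex.ofReal_pow, h4]
  linear_combination (norm := ring_nf)
    -(evalFunction α u s * conj (Complex.Gamma (α / 2 + Complex.I * s)) /
      ((2 * Real.pi * Real.Gamma α : ℝ) : ℂ)) * h1 -
    (((2 ^ (α / 2) : ℝ) : ℂ) * gammaMellin (α / 2) ((z : ℂ) / Complex.I) s /
      ((2 * Real.pi * Real.Gamma α : ℝ) : ℂ)) * h2

theorem memLp_evalFunction {α : ℝ} (hα : 0 < α) (z : ℍ) :
    MemLp (evalFunction α z) 2 (spectralMeasure α) := by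
  rw [memLp_two_iff_integrable_sq_norm (continuous_evalFunction α z).aestronglyMeasurable,
    integrable_spectralMeasure_iff hα]
  have h := memLp_gammaMellin (half_pos hα) (re_div_I_pos z)
  rw [memLp_two_iff_integrable_sq_norm h.1] at h
  refine (h.const_mul (2 ^ α / (2 * Real.pi * Real.Gamma α))).congr (Eventually.of_forall fun s => ?_)
  have h1 := spectralDensity_mul_evalFunction α z z s
  simp only [Complex.conj_mul'] at h1
  simp only [smul_eq_mul]
  exact_mod_cast h1.symm

/-- The Gram matrix of the evaluation functions is the kernel of `H_α`. -/
theorem integral_conj_evalFunction_mul {α : ℝ} (hα : 0 < α) (z u : ℍ) :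
    ∫ s, conj (evalFunction α z s) * evalFunction α u s ∂(spectralMeasure α) =
      halfPlaneKernel α z u := by
  have hG : (Real.Gamma α : ℂ) ≠ 0 := by exact_mod_cast (Real.Gamma_pos_of_pos hα).ne'
  have hpi : (Real.pi : ℂ) ≠ 0 := by exact_mod_cast Real.pi_ne_zero
  rw [integral_spectralMeasure hα]
  simp only [spectralDensity_mul_evalFunction]
  rw [integral_const_mul, integral_conj_gammaMellin_mul (half_pos hα) (re_div_I_pos u)
    (re_div_I_pos z), mul_div_cancel₀ _ two_ne_zero, halfPlaneKernel, Complex.Gamma_ofReal]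
  have h1 : ((z : ℂ) - conj (u : ℂ)) / (2 * Complex.I) ≠ 0 := fun h => by
    have hz := z.im_pos
    have hu := u.im_pos
    simp [sub_eq_zero] at h
    have := congrArg Complex.im h
    simp at this
    linarith
  -- The sum is twice the base of the kernel, and the resulting `2^{-α}` cancels the `2^α` from the
  -- normalisation `2^{α/2}`.
  have h2 : conj ((u : ℂ) / Complex.I) + (z : ℂ) / Complex.I =
      ((2 : ℝ) : ℂ) * (((z : ℂ) - conj (u : ℂ)) / (2 * Complex.I)) := by
    simp only [map_div₀, Complex.conj_I]
    push_cast
    field_simp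
    ring
  have h3 : ((2 ^ α : ℝ) : ℂ) * ((2 : ℝ) : ℂ) ^ (-(α : ℂ)) = 1 := by
    rw [Complex.ofReal_cpow two_pos.le, ← Complex.cpow_add _ _ (by norm_num)]
    simp
  rw [h2, ofReal_mul_cpow two_pos h1, Complex.ofReal_div]
  push_cast at h3 ⊢
  field_simp
  linear_combination ((((z : ℂ) - conj (u : ℂ)) / (2 * Complex.I)) ^ (-(α : ℂ))) * h3

theorem mellinIntegrand_eq (α : ℝ) (f : ℝ → ℂ) (z : ℍ) (s : ℝ) :
    ((2 ^ (α / 2) / (2 * Real.pi * Real.Gamma α) : ℝ) : ℂ) * mellinIntegrand α f z s =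
      (spectralDensity α s : ℂ) * (conj (evalFunction α z s) * f s) := by
  simp only [mellinIntegrand, spectralDensity, evalFunction, Complex.conj_conj]
  push_cast
  ring

theorem twistedMellin_eq_integral {α : ℝ} (hα : 0 < α) (f : ℝ → ℂ) (z : ℍ) :
    twistedMellin α f z = ∫ s, conj (evalFunction α z s) * f s ∂(spectralMeasure α) := by
  rw [twistedMellin, ← integral_const_mul, integral_spectralMeasure hα]
  simp only [mellinIntegrand_eq]

/-- Up to a nonzero constant, this is a product of two `L²(μ)` functions with the density of `μ`
absorbed. -/
theorem integrable_mellinIntegrand {α : ℝ} (hα : 0 < α) (f : Lp ℂ 2 (spectralMeasure α)) (z : ℍ) :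
    Integrable (mellinIntegrand α f z) := by
  have h : Integrable (fun s => conj (evalFunction α z s) * f s) (spectralMeasure α) :=
    (memLp_evalFunction hα z).star.integrable_mul (Lp.memLp f)
  rw [integrable_spectralMeasure_iff hα] at h
  have hc : (2 ^ (α / 2) / (2 * Real.pi * Real.Gamma α) : ℝ) ≠ 0 := by
    have := Real.Gamma_pos_of_pos hα
    positivity
  have hc' : IsUnit ((2 ^ (α / 2) / (2 * Real.pi * Real.Gamma α) : ℝ) : ℂ) :=
    isUnit_iff_ne_zero.2 (by exact_mod_cast hc)
  rw [← integrable_const_mul_iff hc']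
  refine h.congr (Eventually.of_forall fun s => ?_)
  simp only [mellinIntegrand_eq, Complex.real_smul]

/-- `evalFunction` as an element of `L²`. -/
noncomputable def evalVector {α : ℝ} (hα : 0 < α) (z : ℍ) : Lp ℂ 2 (spectralMeasure α) :=
  (memLp_evalFunction hα z).toLp

/-- The inner product is conjugate linear in its first entry, which is why `evalFunction` carries a
conjugate. -/
theorem inner_evalVector {α : ℝ} (hα : 0 < α) (z : ℍ) (f : Lp ℂ 2 (spectralMeasure α)) :
    inner ℂ (evalVector hα z) f = twistedMellin α f z := by
  rw [L2.inner_def, twistedMellin_eq_integral hα]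
  refine integral_congr_ae ?_
  filter_upwards [(memLp_evalFunction hα z).coeFn_toLp] with s hs
  rw [evalVector, hs, RCLike.inner_apply, mul_comm]

theorem inner_evalVector_evalVector {α : ℝ} (hα : 0 < α) (z u : ℍ) :
    inner ℂ (evalVector hα z) (evalVector hα u) = halfPlaneKernel α z u := by
  rw [inner_evalVector, twistedMellin_eq_integral hα, ← integral_conj_evalFunction_mul hα]
  refine integral_congr_ae ?_
  filter_upwards [(memLp_evalFunction hα u).coeFn_toLp] with s hs
  rw [evalVector, hs]

/-- The twisted Mellin transform is injective. -/
theorem eq_zero_of_twistedMellin_eq_zero {α : ℝ} (hα : 0 < α) (f : Lp ℂ 2 (spectralMeasure α))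
    (h : ∀ z, twistedMellin α f z = 0) : f = 0 := by
  -- At the points `i e^{2πξ}` the power becomes `e^{-απξ} e^{-2πisξ}`, a Fourier kernel in `s`.
  let p : ℝ → ℍ := fun ξ => ⟨Complex.I * (Real.exp (2 * Real.pi * ξ) : ℝ), by
    rw [Complex.I_mul_im, Complex.ofReal_re]; exact Real.exp_pos _⟩
  have hp : ∀ ξ s : ℝ, ((p ξ : ℂ) / Complex.I) ^ (-(α / 2 : ℂ) - Complex.I * s) =
      Complex.exp (-(α * Real.pi * ξ)) * Complex.exp (-2 * Real.pi * s * ξ * Complex.I) := by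
    intro ξ s
    have : (p ξ : ℂ) / Complex.I = (Real.exp (2 * Real.pi * ξ) : ℝ) := by
      simp only [p]
      field_simp
    rw [this, Complex.cpow_def_of_ne_zero (by exact_mod_cast (Real.exp_pos _).ne'),
      ← Complex.ofReal_log (Real.exp_pos _).le, Real.log_exp, ← Complex.exp_add]
    congr 1
    push_cast
    ring
  let G : ℝ → ℂ := fun s => f s * (‖Complex.Gamma (α / 2 + Complex.I * s)‖ ^ 2 : ℝ)
  have hG : Integrable G := by
    -- At `z = i` the power is identically `1`.
    refine (integrable_mellinIntegrand hα f (p 0)).congr (Eventually.of_forall fun s => ?_)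
    simp only [mellinIntegrand, hp]
    simp [G]
  have hc : ((2 ^ (α / 2) / (2 * Real.pi * Real.Gamma α) : ℝ) : ℂ) ≠ 0 := by
    have := Real.Gamma_pos_of_pos hα
    exact_mod_cast (by positivity : (2 ^ (α / 2) / (2 * Real.pi * Real.Gamma α) : ℝ) ≠ 0)
  have hF : ∀ ξ, 𝓕 G ξ = 0 := by
    intro ξ
    have h1 := (mul_eq_zero.1 (h (p ξ))).resolve_left hc
    have h2 : ∀ s, mellinIntegrand α f (p ξ) s =
        Complex.exp (-(α * Real.pi * ξ)) * (Complex.exp (↑(-2 * Real.pi * s * ξ) * Complex.I) • G s) := by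
      intro s
      simp only [mellinIntegrand, hp, G, smul_eq_mul]
      push_cast
      ring
    simp only [h2] at h1
    rw [integral_const_mul] at h1
    rw [Real.fourier_real_eq_integral_exp_smul]
    exact (mul_eq_zero.1 h1).resolve_left (Complex.exp_ne_zero _)
  refine (Lp.eq_zero_iff_ae_eq_zero).2 ?_
  -- Vanishing Lebesgue-almost everywhere passes to `μ`; the Gamma factor has no zeros and can be
  -- divided out.
  refine (withDensity_absolutelyContinuous volume _).ae_le ?_
  filter_upwards [ae_eq_zero_of_fourier_eq_zero hG hF] with s hs
  refine (mul_eq_zero.1 hs).resolve_right ?_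
  have := Complex.Gamma_ne_zero_of_re_pos (s := α / 2 + Complex.I * s) (by simpa using hα)
  exact_mod_cast pow_ne_zero 2 (norm_ne_zero_iff.2 this)

/-- The evaluation vectors are total in `L²`. -/
theorem span_evalVector_dense {α : ℝ} (hα : 0 < α) :
    (Submodule.span ℂ (Set.range (evalVector hα))).topologicalClosure = ⊤ := by
  rw [Submodule.topologicalClosure_eq_top_iff, Submodule.eq_bot_iff]
  intro f hf
  refine eq_zero_of_twistedMellin_eq_zero hα f fun z => ?_
  rw [← inner_evalVector hα]
  exact (Submodule.mem_orthogonal _ _).1 hf _ (Submodule.subset_span ⟨z, rfl⟩)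

theorem span_kerFun_dense (α : ℝ) [Fact (0 < α)] :
    (Submodule.span ℂ (Set.range fun z => RKHS.kerFun (HighestWeightSpace α) z (1 : ℂ))
      ).topologicalClosure = ⊤ := by
  rw [← top_le_iff, ← RKHS.kerFun_dense (HighestWeightSpace α)]
  refine Submodule.topologicalClosure_mono (Submodule.span_le.2 ?_)
  rintro _ ⟨z, v, rfl⟩
  rw [← mul_one v, ← smul_eq_mul, map_smul]
  exact Submodule.smul_mem _ _ (Submodule.subset_span ⟨z, rfl⟩)

/-- Replacing `z` by `a⁻¹ z` multiplies the power by `a^{α/2} a^{is}`; the automorphy factor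
`a^{-α/2}` leaves exactly `a^{is}`. -/
theorem twistedMellin_spectralAction {α : ℝ} (hα : 0 < α) (a : ℝ) (ha : 0 < a)
    (f : Lp ℂ 2 (spectralMeasure α)) :
    twistedMellin α (spectralAction α a ha f) =
      highestWeightAction α (diagonalElement a ha) (twistedMellin α f) := by
  ext z
  have h1 : twistedMellin α (spectralAction α a ha f) z =
      twistedMellin α (fun s : ℝ => f s * (a : ℂ) ^ (Complex.I * (s : ℂ))) z := by
    rw [twistedMellin_eq_integral hα, twistedMellin_eq_integral hα]
    refine integral_congr_ae ?_
    filter_upwards [(memLp_spectralAction α a ha f).coeFn_toLp] with s hs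
    rw [spectralAction, hs]
  have ha' : (a : ℂ) ≠ 0 := by exact_mod_cast ha.ne'
  rw [h1, highestWeightAction_diagonalElement, twistedMellin, twistedMellin]
  refine .trans ?_ (mul_assoc _ _ _).symm
  rw [← integral_mul_const]
  congr 2 with s
  simp only [mellinIntegrand]
  have h2 : ((a⁻¹ : ℝ) : ℂ) ^ (-(α / 2 : ℂ) - Complex.I * s) =
      (a : ℂ) ^ (α / 2 : ℂ) * (a : ℂ) ^ (Complex.I * s) := by
    rw [Complex.ofReal_inv, Complex.inv_cpow _ _
      (by simp [Complex.arg_ofReal_of_nonneg ha.le, Real.pi_ne_zero.symm]), ← Complex.cpow_neg,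
      ← Complex.cpow_add _ _ ha']
    congr 1
    ring
  have h3 : (a : ℂ) ^ (α / 2 : ℂ) * ((a ^ (-α / 2) : ℝ) : ℂ) = 1 := by
    rw [Complex.ofReal_cpow ha.le, ← Complex.cpow_add _ _ ha']
    push_cast
    rw [neg_div, add_neg_cancel, Complex.cpow_zero]
  rw [mul_div_assoc, ofReal_mul_cpow (inv_pos.2 ha) (div_I_ne_zero z), h2]
  linear_combination (norm := ring_nf) -(f s * (a : ℂ) ^ (Complex.I * (s : ℂ)) *
    ((z : ℂ) / Complex.I) ^ (-(α / 2 : ℂ) - Complex.I * s) *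
    (‖Complex.Gamma (α / 2 + Complex.I * s)‖ ^ 2 : ℝ)) * h3

end VilenkinMellin

theorem mainTheorem12 (α : ℝ) [Fact (0 < α)] :
    (∀ (f : MeasureTheory.Lp ℂ 2 (VilenkinMellin.spectralMeasure α)) (z : UpperHalfPlane),
      MeasureTheory.Integrable (VilenkinMellin.mellinIntegrand α f z)) ∧
    ∃ J : MeasureTheory.Lp ℂ 2 (VilenkinMellin.spectralMeasure α) ≃ₗᵢ[ℂ] VilenkinMellin.HighestWeightSpace α,
      (∀ (f : MeasureTheory.Lp ℂ 2 (VilenkinMellin.spectralMeasure α)) (z : UpperHalfPlane),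
        J f z = VilenkinMellin.twistedMellin α f z) ∧
      ∀ (a : ℝ) (ha : 0 < a) (f : MeasureTheory.Lp ℂ 2 (VilenkinMellin.spectralMeasure α)),
        (J (VilenkinMellin.spectralAction α a ha f) : UpperHalfPlane → ℂ) =
          VilenkinMellin.highestWeightAction α (VilenkinMellin.diagonalElement a ha) (J f) := by
  have hα : 0 < α := Fact.out
  refine ⟨VilenkinMellin.integrable_mellinIntegrand hα, ?_⟩
  obtain ⟨J, hJ⟩ := VilenkinMellin.exists_linearIsometryEquiv_of_inner_eq
    (VilenkinMellin.evalVector hα)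
    (fun z => RKHS.kerFun (VilenkinMellin.HighestWeightSpace α) z (1 : ℂ))
    (VilenkinMellin.span_evalVector_dense hα) (VilenkinMellin.span_kerFun_dense α)
    (fun z u => by
      rw [VilenkinMellin.inner_evalVector_evalVector, VilenkinMellin.reproducing,
        VilenkinMellin.kerFun_highestWeightSpace])
  have hJf : ∀ f, (J f : UpperHalfPlane → ℂ) = VilenkinMellin.twistedMellin α f := fun f => by
    -- `J f(z) = ⟨Ψ_z, J f⟩ = ⟨J e_z, J f⟩ = ⟨e_z, f⟩`.
    ext z
    rw [← VilenkinMellin.reproducing, ← hJ, J.inner_map_map, VilenkinMellin.inner_evalVector]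
  refine ⟨J, fun f z => congrFun (hJf f) z, fun a ha f => ?_⟩
  rw [hJf, hJf, VilenkinMellin.twistedMellin_spectralAction hα]
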